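/- Let $(L(\theta))_{\theta\in\Theta}$, $\Theta\subseteq\mathbb R^p$, be an integrable real-valued process on a probability space $(\Omega,\mathcal F,\mathbb P)$, and let $\zeta(\theta)=L(\theta)-\mathbb E L(\theta)$ be its stochastic component; assume that almost surely $\zeta$ is differentiable on $\Theta$, with gradient $\nabla\zeta$. Let $\theta^*\in\Theta$, let $V_0$ be a symmetric positive definite $p\times p$ matrix, and put $\Theta_0(r)=\{\theta\in\Theta:\|V_0(\theta-\theta^*)\|\le r\}$. Let $\nu\ge 1$, $\mathtt g>0$ and $\mathtt r_0$ be constants with $\mathtt g_0:=\mathtt g\,\nu\ge 3$, and assume condition $(ED_1)$: for each $0<r\le \mathtt r_0$ there is a constant $0<\varrho(r)\le 1/2$ such that for all $\theta\in\Theta_0(r)$ and all $|\lambda|\le\mathtt g$ $$\sup_{\gamma\in\mathbb R^p\setminus\{0\}}\log\mathbb E\exp\Bigl\{\lambda\,\frac{\gamma^{\top}\{\nabla\zeta(\theta)-\nabla\zeta(\theta^*)\}}{\varrho(r)\,\|V_0\gamma\|}\Bigr\}\le \nu^2\lambda^2/2 .$$ Fix $0<r\le \mathtt r_0$ such that $\Theta_0(r)$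 is convex, and fix $\omega\ge 3\nu\varrho(r)$. Define the upper and lower bracketing errors $$\diamondsuit^{\pm}(r)=\sup_{\theta\in\Theta_0(r)}\Bigl\{\pm\bigl[\zeta(\theta)-\zeta(\theta^*)-(\theta-\theta^*)^{\top}\nabla\zeta(\theta^*)\bigr]-\frac{\omega}{2}\|V_0(\theta-\theta^*)\|^2\Bigr\}.$$ Let $\mathbb Q=2p$ if $p\ge 2$ and $\mathbb Q=2.7$ if $p=1$, and $$z_{\mathbb Q}(x,\mathbb Q)=\begin{cases}\bigl(1+\sqrt{x+\mathbb Q}\bigr)^2,&\text{if }1+\sqrt{x+\mathbb Q}\le \mathtt g_0,\\[2pt] 1+\bigl\{2\mathtt g_0^{-1}(x+\mathbb Q)+\mathtt g_0\bigr\}^2,&\text{otherwise.}\end{cases}$$ Then for every $x\ge 0$ $$\mathbb P\bigl\{\omega^{-1}\diamondsuit^{+}(r)\ge z_{\mathbb Q}(x,\mathbb Q)\bigr\}\le e^{-x}\qquad\text{and}\qquad \mathbb P\bigl\{\omega^{-1}\diamondsuit^{-}(r)\ge z_{\mathbb Q}(x,\mathbb Q)\bigr\}\le e^{-x}.$$ 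-/

import Mathlib

open MeasureTheory ProbabilityTheory

noncomputable section

/-- The parameter space `ℝ^p` with its Euclidean norm. -/
abbrev ParamSpace (p : ℕ) : Type := EuclideanSpace ℝ (Fin p)

/-- The Euclidean norm `‖V γ‖`, for a matrix `V` and a vector `γ`. -/
def matNorm {p : ℕ} (V : Matrix (Fin p) (Fin p) ℝ) (γ : ParamSpace p) : ℝ :=
  ‖Matrix.toEuclideanCLM (𝕜 := ℝ) V γ‖

/-- The local elliptic set `Θ₀(r) = {θ ∈ Θ : ‖V (θ - θ*)‖ ≤ r}`. -/
def localSet {p : ℕ} (Θ : Set (ParamSpace p)) (V : Matrix (Fin p) (Fin p) ℝ)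
    (θs : ParamSpace p) (r : ℝ) : Set (ParamSpace p) :=
  {θ | θ ∈ Θ ∧ matNorm V (θ - θs) ≤ r}

/-- The stochastic component `ζ(θ) = L(θ) - E L(θ)` of the process `L`. -/
def stochComp {Ω : Type*} [MeasurableSpace Ω] {p : ℕ} (μ : Measure Ω)
    (L : ParamSpace p → Ω → ℝ) (θ : ParamSpace p) (w : Ω) : ℝ :=
  L θ w - ∫ w', L θ w' ∂μ

/-- The gradient at `θ` of a function on `Θ`: the vector that represents the Fréchet derivative
within `Θ`. At an interior point of `Θ` it is the usual gradient. -/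
def gradOn {p : ℕ} (Θ : Set (ParamSpace p)) (f : ParamSpace p → ℝ) (θ : ParamSpace p) :
    ParamSpace p :=
  (InnerProductSpace.toDual ℝ (ParamSpace p)).symm (fderivWithin ℝ f Θ θ)

/-- The random gradient `∇ζ(θ)` of the stochastic component. -/
def gradStoch {Ω : Type*} [MeasurableSpace Ω] {p : ℕ} (μ : Measure Ω)
    (L : ParamSpace p → Ω → ℝ) (Θ : Set (ParamSpace p)) (θ : ParamSpace p) (w : Ω) :
    ParamSpace p :=
  gradOn Θ (fun θ' => stochComp μ L θ' w) θ

/-- Condition `(ED₁)` with radius bound `r₀`, function `ρ(·)` and constants `ν`, `g`: for each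
radius `0 < r ≤ r₀`, each `θ ∈ Θ₀(r)`, each direction `γ ≠ 0` and each `|t| ≤ g`, the exponential
moment of order `t` of `γᵀ{∇ζ(θ) - ∇ζ(θ*)} / (ρ(r) ‖V γ‖)` is finite and its logarithm is at most
`ν² t² / 2`. -/
def ConditionED1 {Ω : Type*} [MeasurableSpace Ω] {p : ℕ} (μ : Measure Ω)
    (L : ParamSpace p → Ω → ℝ) (Θ : Set (ParamSpace p)) (V : Matrix (Fin p) (Fin p) ℝ)
    (θs : ParamSpace p) (ν g r₀ : ℝ) (ρ : ℝ → ℝ) : Prop :=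
  ∀ r : ℝ, 0 < r → r ≤ r₀ → 0 < ρ r ∧ ρ r ≤ 1 / 2 ∧
    ∀ θ ∈ localSet Θ V θs r, ∀ γ : ParamSpace p, γ ≠ 0 → ∀ t : ℝ, |t| ≤ g →
      Integrable (fun w => Real.exp (t *
        (inner ℝ γ (gradStoch μ L Θ θ w - gradStoch μ L Θ θs w) / (ρ r * matNorm V γ)))) μ ∧
      Real.log (∫ w, Real.exp (t *
        (inner ℝ γ (gradStoch μ L Θ θ w - gradStoch μ L Θ θs w) / (ρ r * matNorm V γ))) ∂μ)
          ≤ ν ^ 2 * t ^ 2 / 2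

/-- The remainder of the linear approximation,
`ζ(θ, θ*) - (θ - θ*)ᵀ ∇ζ(θ*)`, where `ζ(θ, θ*) = ζ(θ) - ζ(θ*)`. -/
def linRemainder {Ω : Type*} [MeasurableSpace Ω] {p : ℕ} (μ : Measure Ω)
    (L : ParamSpace p → Ω → ℝ) (Θ : Set (ParamSpace p)) (θs θ : ParamSpace p) (w : Ω) : ℝ :=
  stochComp μ L θ w - stochComp μ L θs w - inner ℝ (θ - θs) (gradStoch μ L Θ θs w)

/-- The upper bracketing error: the supremum over `Θ₀(r)`, in the extended reals, of
`ζ(θ, θ*) - (θ - θ*)ᵀ ∇ζ(θ*) - (ω / 2) ‖V (θ - θ*)‖²`. -/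
def upperError {Ω : Type*} [MeasurableSpace Ω] {p : ℕ} (μ : Measure Ω)
    (L : ParamSpace p → Ω → ℝ) (Θ : Set (ParamSpace p)) (V : Matrix (Fin p) (Fin p) ℝ)
    (θs : ParamSpace p) (ω r : ℝ) (w : Ω) : EReal :=
  ⨆ θ ∈ localSet Θ V θs r,
    ((linRemainder μ L Θ θs θ w - ω / 2 * matNorm V (θ - θs) ^ 2 : ℝ) : EReal)

/-- The lower bracketing error: the supremum over `Θ₀(r)`, in the extended reals, of
`-{ζ(θ, θ*) - (θ - θ*)ᵀ ∇ζ(θ*)} - (ω / 2) ‖V (θ - θ*)‖²`. -/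
def lowerError {Ω : Type*} [MeasurableSpace Ω] {p : ℕ} (μ : Measure Ω)
    (L : ParamSpace p → Ω → ℝ) (Θ : Set (ParamSpace p)) (V : Matrix (Fin p) (Fin p) ℝ)
    (θs : ParamSpace p) (ω r : ℝ) (w : Ω) : EReal :=
  ⨆ θ ∈ localSet Θ V θs r,
    ((-linRemainder μ L Θ θs θ w - ω / 2 * matNorm V (θ - θs) ^ 2 : ℝ) : EReal)

/-- The entropy constant: `2.7 p` for `p = 1` and `2 p` for `p ≥ 2`. -/
def entropyConst (p : ℕ) : ℝ := (if p = 1 then 2.7 else 2) * (p : ℝ)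

/-- The quantile bound `z_Q(x, Q)`, with `g₀ = g ν`. -/
def zQuant (g₀ x Q : ℝ) : ℝ :=
  if 1 + Real.sqrt (x + Q) ≤ g₀ then (1 + Real.sqrt (x + Q)) ^ 2
  else 1 + (2 * g₀⁻¹ * (x + Q) + g₀) ^ 2

end

/-! On a convex neighbourhood of `θ*` the remainder `ζ(θ) - ζ(θ*) - (θ - θ*)ᵀ ∇ζ(θ*)` has gradient
`∇ζ(θ) - ∇ζ(θ*)`. An increment of the remainder is the mean of this gradient along a segment, so
Jensen's inequality turns the gradient's exponential moments into sub-Gaussian increments in the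
metric `‖V (θ - θ')‖`, for exponents up to `g ν`. Chaining through dyadic nets then dominates the
supremum over a ball by a random variable of mean at most one, at the price of the entropy
`9 / 4 * p`. Finally the balls around `θ*` are cut into shells: the quadratic penalty grows faster
than the radius, which pays both for the entropy and for the union bound over the shells. -/

section

open Filter Module Set
open scoped ENNReal NNReal Topology

section MetricEntropy

variable {E : Type*} [NormedAddCommGroup E] [NormedSpace ℝ E] [FiniteDimensional ℝ E]

lemma card_le_of_isSeparated_of_subset_closedBall {c : E} {R ε : ℝ≥0} (hε : 0 < ε)
    {S : Finset E} (hS : (S : Set E) ⊆ Metric.closedBall c R)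
    (hsep : Metric.IsSeparated ε (S : Set E)) :
    (S.card : ℝ) ≤ (1 + 2 * R / ε) ^ finrank ℝ E := by
  borelize E
  let m : Measure E := Measure.addHaar
  have hδ : 0 < (ε / 2 : ℝ) := by positivity
  have hRδ : 0 < (R + ε / 2 : ℝ) := by positivity
  have disjoint_balls : (S : Set E).PairwiseDisjoint fun u => Metric.ball u (ε / 2 : ℝ) := by
    intro u hu v hv huv
    refine Metric.ball_disjoint_ball ?_
    have h : (ε : ℝ≥0∞) < edist u v := hsep hu hv huv
    rw [edist_nndist, ENNReal.coe_lt_coe, ← NNReal.coe_lt_coe, coe_nndist] at h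
    linarith
  have balls_subset : (⋃ u ∈ S, Metric.ball u (ε / 2 : ℝ)) ⊆ Metric.ball c (R + ε / 2) :=
    iUnion₂_subset fun u hu =>
      Metric.ball_subset_ball' (by linarith [Metric.mem_closedBall.1 (hS hu)])
  have volume_le : (S.card : ℝ≥0∞) * ENNReal.ofReal ((ε / 2) ^ finrank ℝ E) * m (Metric.ball 0 1) ≤
      ENNReal.ofReal ((R + ε / 2) ^ finrank ℝ E) * m (Metric.ball 0 1) := by
    calc _ = m (⋃ u ∈ S, Metric.ball u (ε / 2 : ℝ)) := by
          rw [measure_biUnion_finset disjoint_balls fun _ _ => measurableSet_ball]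
          simp only [m.addHaar_ball_of_pos _ hδ, Finset.sum_const, nsmul_eq_mul, mul_assoc]
      _ ≤ m (Metric.ball c (R + ε / 2)) := measure_mono balls_subset
      _ = _ := m.addHaar_ball_of_pos _ hRδ
  have card_mul_le : (S.card : ℝ) * (ε / 2) ^ finrank ℝ E ≤ (R + ε / 2) ^ finrank ℝ E := by
    rw [ENNReal.mul_le_mul_iff_left (Metric.measure_ball_pos _ _ zero_lt_one).ne'
      measure_ball_lt_top.ne, ← ENNReal.ofReal_natCast, ← ENNReal.ofReal_mul (by positivity)]
      at volume_le
    exact (ENNReal.ofReal_le_ofReal_iff (by positivity)).1 volume_le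
  calc (S.card : ℝ) ≤ (R + ε / 2) ^ finrank ℝ E / (ε / 2) ^ finrank ℝ E :=
        (le_div_iff₀ (by positivity)).2 card_mul_le
    _ = (1 + 2 * R / ε) ^ finrank ℝ E := by
        rw [← div_pow]
        congr 1
        field_simp
        ring

lemma packingNumber_le_of_subset_closedBall {A : Set E} {c : E} {R ε : ℝ≥0} (hε : 0 < ε)
    (hA : A ⊆ Metric.closedBall c R) :
    Metric.packingNumber ε A ≤ ⌊(1 + 2 * R / ε : ℝ) ^ finrank ℝ E⌋₊ := by
  refine iSup₂_le fun C hCA => iSup_le fun hC => ?_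
  by_contra! hlarge
  obtain ⟨S, hSC, hcard⟩ := exists_subset_encard_eq (Order.add_one_le_of_lt hlarge)
  have hfin : S.Finite := finite_of_encard_eq_coe hcard
  have := Nat.le_floor (card_le_of_isSeparated_of_subset_closedBall (S := hfin.toFinset) hε
    (by simpa using hSC.trans (hCA.trans hA)) (by simpa using hC.subset hSC))
  rw [hfin.encard_eq_coe_toFinset_card] at hcard
  have : hfin.toFinset.card = ⌊(1 + 2 * R / ε : ℝ) ^ finrank ℝ E⌋₊ + 1 := ENat.natCast_inj.1 hcard
  omega

lemma exists_finset_net_of_subset_closedBall {A : Set E} {c : E} {R ε : ℝ} (hR : 0 ≤ R)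
    (hε : 0 < ε) (hA : A ⊆ Metric.closedBall c R) :
    ∃ S : Finset E, ↑S ⊆ A ∧ (S.card : ℝ) ≤ (1 + 2 * R / ε) ^ finrank ℝ E ∧
      ∀ u ∈ A, ∃ v ∈ S, dist u v ≤ ε := by
  lift R to ℝ≥0 using hR
  lift ε to ℝ≥0 using hε.le
  have hpack := packingNumber_le_of_subset_closedBall hε hA
  have hcover : Metric.coveringNumber ε A ≤ ⌊(1 + 2 * R / ε : ℝ) ^ finrank ℝ E⌋₊ :=
    (Metric.coveringNumber_le_packingNumber ε A).trans hpack
  have htop : Metric.coveringNumber ε A ≠ ⊤ := ne_top_of_le_ne_top (ENat.natCast_ne_top _) hcover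
  have hfin : (Metric.minimalCover ε A).Finite := Metric.finite_minimalCover
  refine ⟨hfin.toFinset, by simpa using Metric.minimalCover_subset, ?_, fun u hu => ?_⟩
  · rw [← Metric.encard_minimalCover htop, hfin.encard_eq_coe_toFinset_card] at hcover
    exact (Nat.le_floor_iff (by positivity)).1 (by exact_mod_cast hcover)
  · obtain ⟨v, hv, huv⟩ := Metric.isCover_minimalCover htop hu
    exact ⟨v, by simpa using hv, (edist_le_coe.1 huv)⟩

end MetricEntropy

section Differentiation

variable {E : Type*} [NormedAddCommGroup E] [NormedSpace ℝ E]

lemma tendsto_slope_of_hasDerivAt_of_straddle {f : ℝ → E} {f' : E} {t : ℝ}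
    (hf : HasDerivAt f f' t) {ι : Type*} {l : Filter ι} {a b : ι → ℝ}
    (ha : Tendsto a l (𝓝 t)) (hb : Tendsto b l (𝓝 t)) (hat : ∀ᶠ i in l, a i ≤ t)
    (htb : ∀ᶠ i in l, t ≤ b i) (hab : ∀ᶠ i in l, a i < b i) :
    Tendsto (fun i => slope f (a i) (b i)) l (𝓝 f') := by
  have remainder_le {x : ι → ℝ} (hx : Tendsto x l (𝓝 t))
      (hxl : ∀ᶠ i in l, |x i - t| ≤ |b i - a i|) :
      (fun i => f (x i) - f t - (x i - t) • f') =o[l] fun i => b i - a i :=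
    ((hasDerivAt_iff_isLittleO.1 hf).comp_tendsto hx).trans_isBigO (.of_bound' hxl)
  have hlittle := (remainder_le hb (by
      filter_upwards [hat, htb] with i h₁ h₂
      rw [abs_of_nonneg (by linarith), abs_of_nonneg (by linarith)]
      linarith)).sub (remainder_le ha (by
      filter_upwards [hat, htb] with i h₁ h₂
      rw [abs_of_nonpos (by linarith), abs_of_nonneg (by linarith)]
      linarith))
  have hzero := hlittle.tendsto_inv_smul_nhds_zero.add_const f'
  rw [zero_add] at hzero
  refine hzero.congr' ?_
  filter_upwards [hab] with i hi
  have hne : b i - a i ≠ 0 := by linarith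
  have regroup : f (b i) - f t - (b i - t) • f' - (f (a i) - f t - (a i - t) • f') =
      f (b i) - f (a i) - (b i - a i) • f' := by module
  rw [slope_def_module, regroup, smul_sub, inv_smul_smul₀ hne, sub_add_cancel]

-- Only pathwise derivatives are available, so joint measurability is obtained by approximating them
-- with difference quotients on a grid, which are finite sums of products.
lemma tendsto_sum_indicator_slope_of_hasDerivAt {f : ℝ → E} {f' : E} {t : ℝ} (ht : t ∈ Ioo 0 1)
    (hf : HasDerivAt f f' t) :
    Tendsto (fun n : ℕ => ∑ k ∈ Finset.range n,
      (Ico (k / n : ℝ) ((k + 1) / n)).indicator (fun _ => slope f (k / n : ℝ) ((k + 1) / n)) t)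
      atTop (𝓝 f') := by
  have hfloor : Tendsto (fun n : ℕ => (⌊t * n⌋₊ / n : ℝ)) atTop (𝓝 t) :=
    (tendsto_nat_floor_mul_div_atTop ht.1.le).comp tendsto_natCast_atTop_atTop
  have hfloor_succ : Tendsto (fun n : ℕ => ((⌊t * n⌋₊ + 1) / n : ℝ)) atTop (𝓝 t) := by
    simpa only [add_div, add_zero] using hfloor.add tendsto_one_div_atTop_nhds_zero_nat
  have mem_cell {n : ℕ} (hn : 0 < n) (k : ℕ) :
      t ∈ Ico (k / n : ℝ) ((k + 1) / n) ↔ ⌊t * n⌋₊ = k := by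
    have hn' : (0 : ℝ) < n := by exact_mod_cast hn
    rw [Nat.floor_eq_iff (by have := ht.1; positivity), mem_Ico, div_le_iff₀ hn', lt_div_iff₀ hn']
  refine (tendsto_slope_of_hasDerivAt_of_straddle hf hfloor hfloor_succ ?_ ?_ ?_).congr' ?_
  all_goals filter_upwards [eventually_gt_atTop 0] with n hn
  · exact ((mem_cell hn _).2 rfl).1
  · exact ((mem_cell hn _).2 rfl).2.le
  · gcongr; linarith
  · have hlt : ⌊t * n⌋₊ < n := by
      rw [Nat.floor_lt (by have := ht.1; positivity)]
      exact mul_lt_of_lt_one_left (by exact_mod_cast hn) ht.2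
    rw [Finset.sum_eq_single_of_mem _ (Finset.mem_range.2 hlt)]
    · rw [indicator_of_mem ((mem_cell hn _).2 rfl)]
    · exact fun k _ hk => indicator_of_notMem (fun hmem => hk ((mem_cell hn k).1 hmem).symm) _

lemma ofReal_convex_increment_le_lintegral [CompleteSpace E] {f f' : ℝ → E}
    (hf : ∀ t ∈ Icc (0 : ℝ) 1, HasDerivWithinAt f (f' t) (Icc 0 1) t)
    (hint : IntegrableOn f' (Ioo 0 1)) {φ : E → ℝ} (hφ : ConvexOn ℝ univ φ) (hφc : Continuous φ)
    (hφ₀ : ∀ y, 0 ≤ φ y) :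
    ENNReal.ofReal (φ (f 1 - f 0)) ≤ ∫⁻ t in Ioo (0 : ℝ) 1, ENNReal.ofReal (φ (f' t)) := by
  have increment_eq : f 1 - f 0 = ∫ t in Ioo (0 : ℝ) 1, f' t := by
    rw [← intervalIntegral.integral_eq_sub_of_hasDerivAt_of_le zero_le_one
      (fun t ht => (hf t ht).continuousWithinAt)
      (fun t ht => (hf t (Ioo_subset_Icc_self ht)).hasDerivAt (Icc_mem_nhds ht.1 ht.2))
      ((intervalIntegrable_iff_integrableOn_Ioo_of_le zero_le_one).2 hint),
      intervalIntegral.integral_of_le zero_le_one, integral_Ioc_eq_integral_Ioo]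
  by_cases hφint : IntegrableOn (fun t => φ (f' t)) (Ioo 0 1)
  · have : IsProbabilityMeasure (volume.restrict (Ioo (0 : ℝ) 1)) := ⟨by simp⟩
    rw [increment_eq, ← ofReal_integral_eq_lintegral_ofReal hφint (.of_forall fun _ => hφ₀ _)]
    exact ENNReal.ofReal_le_ofReal (hφ.map_integral_le hφc.continuousOn isClosed_univ
      (.of_forall fun _ => mem_univ _) hint hφint)
  · have htop : ∫⁻ t in Ioo (0 : ℝ) 1, ENNReal.ofReal (φ (f' t)) = ⊤ := by
      by_contra hne
      refine hφint ⟨hφc.comp_aestronglyMeasurable hint.1, ?_⟩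
      rw [hasFiniteIntegral_iff_ofReal (.of_forall fun _ => hφ₀ _)]
      exact lt_top_iff_ne_top.2 hne
    exact htop ▸ le_top

variable {Ω : Type*} [MeasurableSpace Ω] {μ : Measure Ω}

lemma aestronglyMeasurable_of_hasDerivWithinAt {F : ℝ → Ω → E} {F' : Ω → E} {s : Set ℝ} {t : ℝ}
    (hts : t ∈ s) (ht : t ∈ closure (s \ {t})) (hF : ∀ a ∈ s, AEStronglyMeasurable (F a) μ)
    (hderiv : ∀ᵐ w ∂μ, HasDerivWithinAt (fun a => F a w) (F' w) s t) :
    AEStronglyMeasurable F' μ := by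
  obtain ⟨a, ha, hat⟩ := mem_closure_iff_seq_limit.1 ht
  refine aestronglyMeasurable_of_tendsto_ae atTop
    (f := fun n w => slope (fun a => F a w) t (a n))
    (fun n => ((hF _ (ha n).1).sub (hF t hts)).const_smul _) ?_
  filter_upwards [hderiv] with w hw
  exact (hasDerivWithinAt_iff_tendsto_slope.1 hw).comp
    (tendsto_nhdsWithin_iff.2 ⟨hat, .of_forall ha⟩)

lemma aestronglyMeasurable_prod_of_hasDerivWithinAt [SFinite μ] {F D : ℝ → Ω → E}
    (hF : ∀ t ∈ Icc (0 : ℝ) 1, AEStronglyMeasurable (F t) μ)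
    (hderiv : ∀ᵐ w ∂μ, ∀ t ∈ Icc (0 : ℝ) 1,
      HasDerivWithinAt (fun s => F s w) (D t w) (Icc 0 1) t) :
    AEStronglyMeasurable (fun q : ℝ × Ω => D q.1 q.2)
      ((volume.restrict (Ioo (0 : ℝ) 1)).prod μ) := by
  let gridSlope (n k : ℕ) (w : Ω) : E := slope (fun s => F s w) (k / n : ℝ) ((k + 1) / n)
  refine aestronglyMeasurable_of_tendsto_ae atTop
    (f := fun (n : ℕ) q => ∑ k ∈ Finset.range n,
      (Ico (k / n : ℝ) ((k + 1) / n) ×ˢ univ).indicator (fun q => gridSlope n k q.2) q)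
    (fun n => ?_) ?_
  · refine Finset.aestronglyMeasurable_fun_sum _ fun k hk => ?_
    have hkn : (k + 1 : ℝ) ≤ n := by exact_mod_cast Finset.mem_range.1 hk
    have hn : (0 : ℝ) < n := by linarith [k.cast_nonneg (α := ℝ)]
    have hleft : (k / n : ℝ) ∈ Icc (0 : ℝ) 1 :=
      ⟨by positivity, (div_le_one hn).2 (by linarith)⟩
    have hright : ((k + 1) / n : ℝ) ∈ Icc (0 : ℝ) 1 := ⟨by positivity, (div_le_one hn).2 hkn⟩
    exact (((hF _ hright).sub (hF _ hleft)).const_smul _).comp_snd.indicator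
      (measurableSet_Ico.prod .univ)
  · filter_upwards [Measure.quasiMeasurePreserving_fst.ae (ae_restrict_mem measurableSet_Ioo),
      Measure.quasiMeasurePreserving_snd.ae hderiv] with ⟨t, w⟩ ht hw
    have hd : HasDerivAt (fun s => F s w) (D t w) t :=
      (hw t (Ioo_subset_Icc_self ht)).hasDerivAt (Icc_mem_nhds ht.1 ht.2)
    simpa [indicator, gridSlope] using tendsto_sum_indicator_slope_of_hasDerivAt ht hd

-- `F 1 - F 0` is the mean of `D` over `[0, 1]`, so Jensen's inequality moves `φ` inside that mean.
lemma lintegral_convex_increment_le [CompleteSpace E] [SFinite μ] {F D : ℝ → Ω → E}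
    (hF : ∀ t ∈ Icc (0 : ℝ) 1, AEStronglyMeasurable (F t) μ)
    (hderiv : ∀ᵐ w ∂μ, ∀ t ∈ Icc (0 : ℝ) 1,
      HasDerivWithinAt (fun s => F s w) (D t w) (Icc 0 1) t)
    {K : ℝ≥0∞} (hKtop : K ≠ ⊤) (hK : ∀ t ∈ Icc (0 : ℝ) 1, ∫⁻ w, ‖D t w‖ₑ ∂μ ≤ K)
    {φ : E → ℝ} (hφ : ConvexOn ℝ univ φ) (hφc : Continuous φ) (hφ₀ : ∀ y, 0 ≤ φ y) {C : ℝ≥0∞}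
    (hC : ∀ t ∈ Icc (0 : ℝ) 1, ∫⁻ w, ENNReal.ofReal (φ (D t w)) ∂μ ≤ C) :
    ∫⁻ w, ENNReal.ofReal (φ (F 1 w - F 0 w)) ∂μ ≤ C := by
  have hD := aestronglyMeasurable_prod_of_hasDerivWithinAt hF hderiv
  have lintegral_swap_le {f : E → ℝ≥0∞} (hf : Continuous f) {M : ℝ≥0∞}
      (hM : ∀ t ∈ Icc (0 : ℝ) 1, ∫⁻ w, f (D t w) ∂μ ≤ M) :
      ∫⁻ w, (∫⁻ t in Ioo (0 : ℝ) 1, f (D t w)) ∂μ ≤ M := by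
    rw [← lintegral_lintegral_swap (hf.comp_aestronglyMeasurable hD).aemeasurable]
    calc ∫⁻ t in Ioo (0 : ℝ) 1, (∫⁻ w, f (D t w) ∂μ) ≤ ∫⁻ _ in Ioo (0 : ℝ) 1, M :=
          setLIntegral_mono' measurableSet_Ioo fun t ht => hM t (Ioo_subset_Icc_self ht)
      _ = M := by simp
  have hfinite : ∀ᵐ w ∂μ, ∫⁻ t in Ioo (0 : ℝ) 1, ‖D t w‖ₑ < ⊤ :=
    ae_lt_top' (hD.enorm.prod_swap.lintegral_prod_right')
      (ne_top_of_le_ne_top hKtop (lintegral_swap_le continuous_enorm hK))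
  refine le_trans (lintegral_mono_ae ?_)
    (lintegral_swap_le (ENNReal.continuous_ofReal.comp hφc) hC)
  filter_upwards [hderiv, hfinite, hD.prod_swap.prodMk_left] with w hw hfin hDw
  exact ofReal_convex_increment_le_lintegral hw ⟨hDw, hfin⟩ hφ hφc hφ₀

lemma lintegral_enorm_le_of_lintegral_exp_le {Y : Ω → ℝ} {a : ℝ} {M : ℝ≥0∞} (ha : 0 < a)
    (hY : AEMeasurable Y μ) (hpos : ∫⁻ w, ENNReal.ofReal (Real.exp (a * Y w)) ∂μ ≤ M)
    (hneg : ∫⁻ w, ENNReal.ofReal (Real.exp (-a * Y w)) ∂μ ≤ M) :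
    ∫⁻ w, ‖Y w‖ₑ ∂μ ≤ ENNReal.ofReal a⁻¹ * (M + M) := by
  have abs_le (y : ℝ) : |y| ≤ a⁻¹ * (Real.exp (a * y) + Real.exp (-a * y)) := by
    rw [le_inv_mul_iff₀ ha, neg_mul, ← abs_of_pos ha, ← abs_mul, abs_of_pos ha]
    linarith [Real.add_one_le_exp |a * y|, Real.exp_abs_le (a * y)]
  calc ∫⁻ w, ‖Y w‖ₑ ∂μ ≤ ∫⁻ w, ENNReal.ofReal a⁻¹ * (ENNReal.ofReal (Real.exp (a * Y w)) +
        ENNReal.ofReal (Real.exp (-a * Y w))) ∂μ := by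
        refine lintegral_mono fun w => ?_
        rw [Real.enorm_eq_ofReal_abs, ← ENNReal.ofReal_add (by positivity) (by positivity),
          ← ENNReal.ofReal_mul (by positivity)]
        exact ENNReal.ofReal_le_ofReal (abs_le _)
    _ = ENNReal.ofReal a⁻¹ * (∫⁻ w, ENNReal.ofReal (Real.exp (a * Y w)) ∂μ +
        ∫⁻ w, ENNReal.ofReal (Real.exp (-a * Y w)) ∂μ) := by
        rw [lintegral_const_mul' _ _ (by finiteness), lintegral_add_left' (by fun_prop)]
    _ ≤ ENNReal.ofReal a⁻¹ * (M + M) := by gcongr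

end Differentiation

section Chaining

lemma tsum_ofReal_half_pow_succ : ∑' j : ℕ, ENNReal.ofReal ((1 / 2) ^ (j + 1)) = 1 := by
  have hsum : HasSum (fun j : ℕ => (1 / 2 : ℝ) ^ (j + 1)) 1 := by
    simpa [pow_succ'] using hasSum_geometric_two.mul_left (1 / 2 : ℝ)
  rw [← ENNReal.ofReal_tsum_of_nonneg (fun _ => by positivity) hsum.summable, hsum.tsum_eq,
    ENNReal.ofReal_one]

variable {Ω : Type*} [MeasurableSpace Ω] {μ : Measure Ω} {E : Type*}

/-- The increments of `X` over `A` have the exponential moments of a standard Gaussian process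
indexed by the metric of `E`, for exponents `κ` with `κ * dist u v ≤ l`. Almost all paths are
continuous, which makes suprema over uncountable `A` tractable. -/
structure HasLocalSubgaussianIncrements [PseudoMetricSpace E] (X : E → Ω → ℝ) (A : Set E) (l : ℝ)
    (μ : Measure Ω) : Prop where
  aemeasurable : ∀ u ∈ A, AEMeasurable (X u) μ
  ae_continuousOn : ∀ᵐ w ∂μ, ContinuousOn (fun u => X u w) A
  lintegral_exp_sub_le : ∀ u ∈ A, ∀ v ∈ A, ∀ κ : ℝ, 0 ≤ κ → κ * dist u v ≤ l →
    ∫⁻ w, ENNReal.ofReal (Real.exp (κ * (X u w - X v w))) ∂μ ≤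
      ENNReal.ofReal (Real.exp ((κ * dist u v) ^ 2 / 2))

namespace HasLocalSubgaussianIncrements

variable [PseudoMetricSpace E] {X : E → Ω → ℝ} {A B : Set E} {l l' : ℝ}

lemma mono (h : HasLocalSubgaussianIncrements X A l μ) (hBA : B ⊆ A) (hl : l' ≤ l) :
    HasLocalSubgaussianIncrements X B l' μ where
  aemeasurable u hu := h.aemeasurable u (hBA hu)
  ae_continuousOn := h.ae_continuousOn.mono fun _ hw => hw.mono hBA
  lintegral_exp_sub_le u hu v hv κ hκ hκl :=
    h.lintegral_exp_sub_le u (hBA hu) v (hBA hv) κ hκ (hκl.trans hl)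

lemma neg (h : HasLocalSubgaussianIncrements X A l μ) :
    HasLocalSubgaussianIncrements (fun u w => -X u w) A l μ where
  aemeasurable u hu := (h.aemeasurable u hu).neg
  ae_continuousOn := h.ae_continuousOn.mono fun _ hw => hw.neg
  lintegral_exp_sub_le u hu v hv κ hκ hκl := by
    rw [dist_comm] at hκl ⊢
    simpa only [neg_sub_neg] using h.lintegral_exp_sub_le v hv u hu κ hκ hκl

end HasLocalSubgaussianIncrements

/-- Finite nets `net k` of `A` at the scales `s / 2 ^ k`, starting from the single point `c`,
together with a choice `proj k` of nearby points in `net k`. -/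
structure DyadicNet [PseudoMetricSpace E] (A : Set E) (c : E) (s : ℝ) where
  net : ℕ → Finset E
  proj : ℕ → E → E
  net_zero : net 0 = {c}
  net_subset : ∀ k, ∀ u ∈ net k, u ∈ A
  proj_mem : ∀ k, ∀ u ∈ A, proj k u ∈ net k
  dist_proj_le : ∀ k, ∀ u ∈ A, dist u (proj k u) ≤ s / 2 ^ k

namespace DyadicNet

variable [PseudoMetricSpace E] {A : Set E} {c : E} {s : ℝ} (N : DyadicNet A c s)

lemma tendsto_proj {u : E} (hu : u ∈ A) : Tendsto (fun k => N.proj k u) atTop (𝓝[A] u) := by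
  refine tendsto_nhdsWithin_iff.2
    ⟨?_, .of_forall fun k => N.net_subset k _ (N.proj_mem k u hu)⟩
  have hscale : Tendsto (fun k : ℕ => s / 2 ^ k) atTop (𝓝 0) :=
    tendsto_const_nhds.div_atTop (tendsto_pow_atTop_atTop_of_one_lt one_lt_two)
  exact tendsto_iff_dist_tendsto_zero.2 (squeeze_zero (fun _ => dist_nonneg)
    (fun k => (dist_comm _ _).trans_le (N.dist_proj_le k u hu)) hscale)

/-- The exponential of the increment of `f` along the link from `u` to level `j`. The factor
`l * 2 ^ j / s` is the largest exponent that links of length `s / 2 ^ j` admit, and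
`exp (l ^ 2 / 2)` is the resulting bound on the exponential moment, so the mean is at most `1`. -/
noncomputable def linkExp (f : E → ℝ) (l : ℝ) (j : ℕ) (u : E) : ℝ :=
  Real.exp (l * 2 ^ j / s * (f u - f (N.proj j u)) - l ^ 2 / 2)

/-- The mean of `linkExp` over the points of level `j + 1`. -/
noncomputable def linkMean (f : E → ℝ) (l : ℝ) (j : ℕ) : ℝ :=
  (∑ u ∈ N.net (j + 1), N.linkExp f l j u) / (N.net (j + 1)).card

/-- The geometrically weighted link means, which control all increments of `f` from `c` at once. -/
noncomputable def majorant (f : E → ℝ) (l : ℝ) : ℝ≥0∞ :=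
  ∑' j, ENNReal.ofReal ((1 / 2) ^ (j + 1) * N.linkMean f l j)

lemma linkExp_pos (f : E → ℝ) (l : ℝ) (j : ℕ) (u : E) : 0 < N.linkExp f l j u :=
  Real.exp_pos _

lemma linkMean_nonneg (f : E → ℝ) (l : ℝ) (j : ℕ) : 0 ≤ N.linkMean f l j :=
  div_nonneg (Finset.sum_nonneg fun u _ => (N.linkExp_pos f l j u).le) (Nat.cast_nonneg _)

-- The tangent line at `τ` replaces the logarithm of `linkMean`: it is affine, so that the bounds of
-- all levels can be summed under a single expectation.
lemma link_le {f : E → ℝ} {l : ℝ} {j : ℕ} {u : E} (hu : u ∈ N.net (j + 1)) (τ : ℝ) :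
    l * 2 ^ j / s * (f u - f (N.proj j u)) ≤
      l ^ 2 / 2 + Real.log (N.net (j + 1)).card + (τ - 1) + Real.exp (-τ) * N.linkMean f l j := by
  have hcard : (0 : ℝ) < (N.net (j + 1)).card := by exact_mod_cast Finset.card_pos.2 ⟨u, hu⟩
  have exp_le : Real.exp (l * 2 ^ j / s * (f u - f (N.proj j u)) - l ^ 2 / 2 -
      Real.log (N.net (j + 1)).card) ≤ N.linkMean f l j := by
    rw [Real.exp_sub, Real.exp_log hcard, linkMean]
    gcongr
    exact Finset.single_le_sum (f := N.linkExp f l j) (fun v _ => (N.linkExp_pos f l j v).le) hu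
  have tangent := Real.add_one_le_exp (-τ + (l * 2 ^ j / s * (f u - f (N.proj j u)) - l ^ 2 / 2 -
    Real.log (N.net (j + 1)).card))
  rw [Real.exp_add] at tangent
  linarith [mul_le_mul_of_nonneg_left exp_le (Real.exp_pos (-τ)).le]

lemma chain_le {f : E → ℝ} {l : ℝ} (τ : ℝ) {k : ℕ} {v : E} (hv : v ∈ N.net k) :
    l * (f v - f c) / (2 * s) ≤ ∑ j ∈ Finset.range k, (1 / 2) ^ (j + 1) *
      (l ^ 2 / 2 + Real.log (N.net (j + 1)).card + (τ - 1) +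
        Real.exp (-τ) * N.linkMean f l j) := by
  induction k generalizing v with
  | zero =>
    rw [N.net_zero, Finset.mem_singleton] at hv
    simp [hv]
  | succ k ih =>
    rw [Finset.sum_range_succ]
    have hlink := mul_le_mul_of_nonneg_left (N.link_le (f := f) (l := l) hv τ)
      (by positivity : (0 : ℝ) ≤ (1 / 2) ^ (k + 1))
    have telescope : l * (f v - f c) / (2 * s) = l * (f (N.proj k v) - f c) / (2 * s) +
        (1 / 2) ^ (k + 1) * (l * 2 ^ k / s * (f v - f (N.proj k v))) := by
      have : (1 / 2 : ℝ) ^ k * 2 ^ k = 1 := by rw [← mul_pow]; norm_num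
      linear_combination (-(l * (f v - f (N.proj k v)) / (2 * s))) * this
    exact telescope.trans_le
      (add_le_add (ih (N.proj_mem k v (N.net_subset _ v hv))) hlink)

lemma chain_le_majorant {f : E → ℝ} {l M : ℝ} (τ : ℝ)
    (hM : ∀ k, ∑ j ∈ Finset.range k, (1 / 2) ^ (j + 1) * Real.log (N.net (j + 1)).card ≤ M)
    (hfin : N.majorant f l ≠ ⊤) {k : ℕ} {v : E} (hv : v ∈ N.net k) :
    l * (f v - f c) / (2 * s) ≤ (l ^ 2 / 2 + τ - 1) * (1 - (1 / 2) ^ k) + M +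
      Real.exp (-τ) * (N.majorant f l).toReal := by
  have weights_sum : ∑ j ∈ Finset.range k, (1 / 2 : ℝ) ^ (j + 1) = 1 - (1 / 2) ^ k := by
    simp_rw [pow_succ', ← Finset.mul_sum, geom_sum_eq (by norm_num : (1 / 2 : ℝ) ≠ 1)]
    ring
  have links_le : ∑ j ∈ Finset.range k, (1 / 2) ^ (j + 1) * N.linkMean f l j ≤
      (N.majorant f l).toReal := by
    rw [← ENNReal.ofReal_le_iff_le_toReal hfin, ENNReal.ofReal_sum_of_nonneg fun j _ =>
      mul_nonneg (by positivity) (N.linkMean_nonneg f l j)]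
    exact ENNReal.sum_le_tsum _
  calc _ ≤ _ := N.chain_le τ hv
    _ = (l ^ 2 / 2 + τ - 1) * ∑ j ∈ Finset.range k, (1 / 2 : ℝ) ^ (j + 1) +
        ∑ j ∈ Finset.range k, (1 / 2) ^ (j + 1) * Real.log (N.net (j + 1)).card +
        Real.exp (-τ) * ∑ j ∈ Finset.range k, (1 / 2) ^ (j + 1) * N.linkMean f l j := by
      simp_rw [Finset.mul_sum, ← Finset.sum_add_distrib]
      exact Finset.sum_congr rfl fun j _ => by ring
    _ ≤ _ := by
      rw [weights_sum]
      gcongr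
      exact hM k

lemma exp_le_majorant {f : E → ℝ} (hf : ContinuousOn f A) {l M : ℝ}
    (hM : ∀ k, ∑ j ∈ Finset.range k, (1 / 2) ^ (j + 1) * Real.log (N.net (j + 1)).card ≤ M)
    {u : E} (hu : u ∈ A) :
    ENNReal.ofReal (Real.exp (l * (f u - f c) / (2 * s) - (l ^ 2 / 2 + M))) ≤
      N.majorant f l := by
  by_cases hfin : N.majorant f l = ⊤
  · exact hfin ▸ le_top
  have le_of_forall_net (τ : ℝ) : l * (f u - f c) / (2 * s) ≤
      (l ^ 2 / 2 + τ - 1) * (1 - 0) + M + Real.exp (-τ) * (N.majorant f l).toReal := by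
    have hlim : Tendsto (fun k => l * (f (N.proj k u) - f c) / (2 * s)) atTop
        (𝓝 (l * (f u - f c) / (2 * s))) :=
      ((((hf u hu).tendsto.comp (N.tendsto_proj hu)).sub_const _).const_mul _).div_const _
    have hgeom : Tendsto (fun k : ℕ => (1 / 2 : ℝ) ^ k) atTop (𝓝 0) :=
      tendsto_pow_atTop_nhds_zero_of_lt_one (by norm_num) (by norm_num)
    exact le_of_tendsto_of_tendsto' hlim
      ((((hgeom.const_sub 1).const_mul _).add_const _).add_const _)
      fun k => N.chain_le_majorant τ hM hfin (N.proj_mem k u hu)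
  rw [ENNReal.ofReal_le_iff_le_toReal hfin]
  set y := l * (f u - f c) / (2 * s) - (l ^ 2 / 2 + M) with hy
  have one_le : 1 ≤ Real.exp (-y) * (N.majorant f l).toReal := by
    linarith [le_of_forall_net y]
  rwa [Real.exp_neg, inv_mul_eq_div, one_le_div (Real.exp_pos y)] at one_le

variable {X : E → Ω → ℝ} {l : ℝ}

lemma aemeasurable_linkExp (h : ∀ u ∈ A, AEMeasurable (X u) μ) (j : ℕ) {u : E} (hu : u ∈ A) :
    AEMeasurable (fun w => N.linkExp (fun v => X v w) l j u) μ := by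
  have hproj := h _ (N.net_subset _ _ (N.proj_mem j u hu))
  exact Real.measurable_exp.comp_aemeasurable ((((h u hu).sub hproj).const_mul _).sub_const _)

lemma aemeasurable_linkMean (h : ∀ u ∈ A, AEMeasurable (X u) μ) (j : ℕ) :
    AEMeasurable (fun w => N.linkMean (fun u => X u w) l j) μ :=
  (Finset.aemeasurable_fun_sum _ fun u hu =>
    N.aemeasurable_linkExp h j (N.net_subset _ u hu)).div_const _

lemma aemeasurable_majorant (h : ∀ u ∈ A, AEMeasurable (X u) μ) :
    AEMeasurable (fun w => N.majorant (fun u => X u w) l) μ :=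
  .tsum fun j => ((N.aemeasurable_linkMean h j).const_mul _).ennreal_ofReal

lemma lintegral_linkExp_le (h : HasLocalSubgaussianIncrements X A l μ) (hs : 0 < s) (hl : 0 ≤ l)
    (j : ℕ) {u : E} (hu : u ∈ A) :
    ∫⁻ w, ENNReal.ofReal (N.linkExp (fun v => X v w) l j u) ∂μ ≤ 1 := by
  have link_exponent_le : l * 2 ^ j / s * dist u (N.proj j u) ≤ l := by
    calc l * 2 ^ j / s * dist u (N.proj j u) ≤ l * 2 ^ j / s * (s / 2 ^ j) := by
          gcongr
          exact N.dist_proj_le j u hu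
      _ = l := by field_simp
  simp_rw [linkExp, sub_eq_add_neg _ (l ^ 2 / 2), Real.exp_add,
    ENNReal.ofReal_mul (Real.exp_pos _).le]
  rw [lintegral_mul_const' _ _ ENNReal.ofReal_ne_top]
  calc _ ≤ ENNReal.ofReal (Real.exp (l ^ 2 / 2)) * ENNReal.ofReal (Real.exp (-(l ^ 2 / 2))) := by
        gcongr
        refine (h.lintegral_exp_sub_le u hu _ (N.net_subset _ _ (N.proj_mem j u hu)) _
          (by positivity) link_exponent_le).trans (ENNReal.ofReal_le_ofReal ?_)
        gcongr
    _ = 1 := by rw [← ENNReal.ofReal_mul (Real.exp_pos _).le, ← Real.exp_add]; simp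

lemma lintegral_linkMean_le (h : HasLocalSubgaussianIncrements X A l μ) (hs : 0 < s) (hl : 0 ≤ l)
    (j : ℕ) : ∫⁻ w, ENNReal.ofReal (N.linkMean (fun u => X u w) l j) ∂μ ≤ 1 := by
  simp_rw [linkMean, div_eq_inv_mul, ENNReal.ofReal_mul (inv_nonneg.2 (Nat.cast_nonneg _)),
    ENNReal.ofReal_sum_of_nonneg fun u _ => (N.linkExp_pos _ l j u).le]
  rw [lintegral_const_mul' _ _ ENNReal.ofReal_ne_top, lintegral_finsetSum' _ fun u hu =>
    (N.aemeasurable_linkExp h.aemeasurable j (N.net_subset _ u hu)).ennreal_ofReal]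
  calc _ ≤ ENNReal.ofReal ((N.net (j + 1)).card : ℝ)⁻¹ * ∑ _u ∈ N.net (j + 1), 1 := by
        gcongr with u hu
        exact N.lintegral_linkExp_le h hs hl j (N.net_subset _ u hu)
    _ = ENNReal.ofReal (((N.net (j + 1)).card : ℝ)⁻¹ * (N.net (j + 1)).card) := by
        rw [ENNReal.ofReal_mul (by positivity), ENNReal.ofReal_natCast, Finset.sum_const,
          nsmul_one]
    _ ≤ 1 := ENNReal.ofReal_le_one.2 inv_mul_le_one

lemma lintegral_majorant_le (h : HasLocalSubgaussianIncrements X A l μ) (hs : 0 < s)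
    (hl : 0 ≤ l) : ∫⁻ w, N.majorant (fun u => X u w) l ∂μ ≤ 1 := by
  simp_rw [majorant]
  rw [lintegral_tsum fun j =>
    ((N.aemeasurable_linkMean h.aemeasurable j).const_mul _).ennreal_ofReal]
  calc _ ≤ ∑' j : ℕ, ENNReal.ofReal ((1 / 2) ^ (j + 1)) := by
        refine ENNReal.tsum_le_tsum fun j => ?_
        simp_rw [ENNReal.ofReal_mul (by positivity : (0 : ℝ) ≤ (1 / 2) ^ (j + 1))]
        rw [lintegral_const_mul' _ _ ENNReal.ofReal_ne_top]
        exact mul_le_of_le_one_right' (N.lintegral_linkMean_le h hs hl j)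
    _ = 1 := tsum_ofReal_half_pow_succ

end DyadicNet

section FiniteDimensional

lemma log_one_add_two_pow_le (k : ℕ) :
    Real.log (1 + 2 ^ k) ≤ k * Real.log 2 + (1 / 2) ^ k := by
  have hfactor : (1 + 2 ^ k : ℝ) = 2 ^ k * (1 + (1 / 2) ^ k) := by
    rw [mul_add, ← mul_pow]
    norm_num [add_comm]
  rw [hfactor, Real.log_mul (by positivity) (by positivity), Real.log_pow]
  gcongr
  linarith [Real.log_le_sub_one_of_pos (by positivity : (0 : ℝ) < 1 + (1 / 2) ^ k)]

lemma sum_half_pow_mul_log_le (k : ℕ) :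
    ∑ j ∈ Finset.range k, (1 / 2 : ℝ) ^ (j + 1) * Real.log (1 + 2 ^ (j + 2)) ≤ 9 / 4 := by
  have closed_form : ∑ j ∈ Finset.range k, (1 / 2 : ℝ) ^ (j + 1) *
      ((j + 2 : ℕ) * Real.log 2 + (1 / 2) ^ (j + 2)) =
      Real.log 2 * (3 - (k + 3) * (1 / 2) ^ k) + (1 - ((1 / 2) ^ k) ^ 2) / 6 := by
    induction k with
    | zero => simp
    | succ k ih =>
      rw [Finset.sum_range_succ, ih]
      push_cast
      ring
  have hlog : Real.log 2 * (3 - (k + 3) * (1 / 2) ^ k) ≤ Real.log 2 * 3 := by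
    gcongr
    exact sub_le_self _ (by positivity)
  calc _ ≤ _ := Finset.sum_le_sum fun j _ =>
        mul_le_mul_of_nonneg_left (log_one_add_two_pow_le (j + 2)) (by positivity)
    _ ≤ 9 / 4 := by
        rw [closed_form]
        linarith [Real.log_two_lt_d9, sq_nonneg ((1 / 2 : ℝ) ^ k)]

variable [NormedAddCommGroup E] [NormedSpace ℝ E] [FiniteDimensional ℝ E] {A : Set E} {c : E}
  {s : ℝ}

lemma exists_dyadicNet_level (hs : 0 < s) (hc : c ∈ A) (hA : A ⊆ Metric.closedBall c s) (k : ℕ) :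
    ∃ S : Finset E, (k = 0 → S = {c}) ∧ (∀ u ∈ S, u ∈ A) ∧
      (S.card : ℝ) ≤ (1 + 2 ^ (k + 1)) ^ finrank ℝ E ∧ ∀ u ∈ A, ∃ v ∈ S, dist u v ≤ s / 2 ^ k := by
  rcases k.eq_zero_or_pos with rfl | hk
  · refine ⟨{c}, fun _ => rfl, by simpa using hc, ?_, fun u hu => ⟨c, by simp, ?_⟩⟩
    · simpa using one_le_pow₀ (by norm_num : (1 : ℝ) ≤ 1 + 2)
    · simpa using hA hu
  · obtain ⟨S, hSA, hcard, hcover⟩ :=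
      exists_finset_net_of_subset_closedBall hs.le (by positivity : 0 < s / 2 ^ k) hA
    refine ⟨S, fun h => absurd h hk.ne', hSA, hcard.trans_eq ?_, hcover⟩
    congr 2
    field_simp
    ring

lemma exists_dyadicNet (hs : 0 < s) (hc : c ∈ A) (hA : A ⊆ Metric.closedBall c s) :
    ∃ N : DyadicNet A c s, ∀ k, ∑ j ∈ Finset.range k,
      (1 / 2) ^ (j + 1) * Real.log (N.net (j + 1)).card ≤ 9 / 4 * finrank ℝ E := by
  choose net net_zero net_subset card_le hcover using exists_dyadicNet_level hs hc hA
  have (k : ℕ) (u : E) : ∃ v, u ∈ A → v ∈ net k ∧ dist u v ≤ s / 2 ^ k := by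
    by_cases hu : u ∈ A
    · exact (hcover k u hu).imp fun v hv _ => hv
    · exact ⟨u, fun h => absurd h hu⟩
  choose proj hproj using this
  refine ⟨⟨net, proj, net_zero 0 rfl, net_subset, fun k u hu => (hproj k u hu).1,
    fun k u hu => (hproj k u hu).2⟩, fun k => ?_⟩
  have log_card_le (j : ℕ) :
      Real.log (net (j + 1)).card ≤ finrank ℝ E * Real.log (1 + 2 ^ (j + 2)) := by
    rw [← Real.log_pow]
    exact Real.log_le_log
      (by exact_mod_cast Finset.card_pos.2 ⟨_, (hproj (j + 1) c hc).1⟩) (card_le (j + 1))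
  calc _ ≤ ∑ j ∈ Finset.range k,
        (1 / 2) ^ (j + 1) * (finrank ℝ E * Real.log (1 + 2 ^ (j + 2))) := by
        gcongr with j
        exact log_card_le j
    _ = finrank ℝ E * ∑ j ∈ Finset.range k, (1 / 2) ^ (j + 1) * Real.log (1 + 2 ^ (j + 2)) := by
        rw [Finset.mul_sum]
        exact Finset.sum_congr rfl fun j _ => by ring
    _ ≤ finrank ℝ E * (9 / 4) := by
        gcongr
        exact sum_half_pow_mul_log_le k
    _ = _ := mul_comm _ _

lemma HasLocalSubgaussianIncrements.measure_exists_ge_le {X : E → Ω → ℝ} {l : ℝ}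
    (h : HasLocalSubgaussianIncrements X A l μ) (hs : 0 < s) (hl : 0 ≤ l) (hc : c ∈ A)
    (hA : A ⊆ Metric.closedBall c s) (τ : ℝ) :
    μ {w | ∃ u ∈ A, l ^ 2 / 2 + 9 / 4 * finrank ℝ E + τ ≤ l * (X u w - X c w) / (2 * s)} ≤
      ENNReal.ofReal (Real.exp (-τ)) := by
  obtain ⟨N, hN⟩ := exists_dyadicNet hs hc hA
  let Z (w : Ω) : ℝ≥0∞ := N.majorant (fun u => X u w) l
  have subset_level : ∀ᵐ w ∂μ,
      (∃ u ∈ A, l ^ 2 / 2 + 9 / 4 * finrank ℝ E + τ ≤ l * (X u w - X c w) / (2 * s)) →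
      ENNReal.ofReal (Real.exp τ) ≤ Z w := by
    filter_upwards [h.ae_continuousOn] with w hw
    rintro ⟨u, hu, hlarge⟩
    refine le_trans (ENNReal.ofReal_le_ofReal (Real.exp_le_exp.2 ?_)) (N.exp_le_majorant hw hN hu)
    linarith
  calc _ ≤ μ {w | ENNReal.ofReal (Real.exp τ) ≤ Z w} := measure_mono_ae subset_level
    _ ≤ (∫⁻ w, Z w ∂μ) / ENNReal.ofReal (Real.exp τ) :=
        meas_ge_le_lintegral_div (N.aemeasurable_majorant h.aemeasurable)
          (by simpa using Real.exp_pos τ) ENNReal.ofReal_ne_top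
    _ ≤ 1 / ENNReal.ofReal (Real.exp τ) := by
        gcongr
        exact N.lintegral_majorant_le h hs hl
    _ = ENNReal.ofReal (Real.exp (-τ)) := by
        rw [one_div, ← ENNReal.ofReal_inv_of_pos (Real.exp_pos τ), Real.exp_neg]

end FiniteDimensional

end Chaining

section Peeling

/-- The radii, in units of the square root of the level, of the balls on which a quadratically
penalized process is bounded by chaining. They are chosen so that `exists_shell` gains a factor
`11 / 10` on every shell, which pays for the entropy, and a factor linear in `j`, which pays for
the weights `2 ^ (-j)` of the union bound. -/
noncomputable def shellRadius (j : ℕ) : ℝ := 9 / 10 + 3 / 10 * j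

lemma shellRadius_pos (j : ℕ) : 0 < shellRadius j := by
  unfold shellRadius
  positivity

lemma exists_shell (d : ℝ) :
    ∃ j : ℕ, d ≤ shellRadius j ∧
      max (11 / 10 : ℝ) (3 / 20 * (j + 1)) * shellRadius j ≤ 1 + d ^ 2 / 2 := by
  have le_radius := Nat.le_ceil ((d - 9 / 10) / (3 / 10))
  refine ⟨⌈(d - 9 / 10) / (3 / 10)⌉₊, by unfold shellRadius; linarith, ?_⟩
  rw [max_mul_of_nonneg _ _ (shellRadius_pos _).le]
  rcases le_or_gt d (9 / 10) with hd | hd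
  · rw [Nat.ceil_eq_zero.2 (by linarith)]
    norm_num [shellRadius]
    nlinarith [sq_nonneg d]
  · have radius_lt := Nat.ceil_lt_add_one (by linarith : 0 ≤ (d - 9 / 10) / (3 / 10))
    unfold shellRadius
    generalize (⌈(d - 9 / 10) / (3 / 10)⌉₊ : ℝ) = k at *
    refine max_le ?_ ?_
    · nlinarith [sq_nonneg (d - 11 / 10)]
    · nlinarith

lemma shell_exponent_le {p x K : ℝ} (hp : 0 ≤ p) (hx : 0 ≤ x)
    (hK : 9 / 4 * p + x + 5 ≤ 23 / 20 * K) (j : ℕ) :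
    K / 2 + 9 / 4 * p + (x + (j + 1) * Real.log 2) ≤
      3 / 2 * K * max (11 / 10 : ℝ) (3 / 20 * (j + 1)) := by
  have hlog := Real.log_two_lt_d9
  rcases le_or_gt j 6 with hj | hj
  · have hj' : (j : ℝ) + 1 ≤ 7 := by exact_mod_cast Nat.succ_le_succ hj
    have weight_le : (j + 1) * Real.log 2 ≤ 5 := by nlinarith [Real.log_two_gt_d9]
    nlinarith [le_max_left (11 / 10 : ℝ) (3 / 20 * (j + 1))]
  · have hj' : (8 : ℝ) ≤ j + 1 := by exact_mod_cast Nat.succ_le_succ hj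
    nlinarith [le_max_right (11 / 10 : ℝ) (3 / 20 * (j + 1))]

lemma exp_neg_add_succ_mul_log_two (x : ℝ) (j : ℕ) :
    Real.exp (-(x + (j + 1) * Real.log 2)) = Real.exp (-x) * (1 / 2) ^ (j + 1) := by
  have half_pow : Real.exp (-((j + 1 : ℕ) * Real.log 2)) = (1 / 2) ^ (j + 1) := by
    rw [Real.exp_neg, Real.exp_nat_mul, Real.exp_log two_pos, one_div, inv_pow]
  rw [← half_pow, ← Real.exp_add, neg_add, Nat.cast_succ]

variable {Ω : Type*} [MeasurableSpace Ω] {μ : Measure Ω}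
  {E : Type*} [NormedAddCommGroup E] [NormedSpace ℝ E] [FiniteDimensional ℝ E]
  {X : E → Ω → ℝ} {B : Set E} {c : E} {x : ℝ}

namespace HasLocalSubgaussianIncrements

lemma measure_exists_penalized_ge_le {l q : ℝ} (h : HasLocalSubgaussianIncrements X B l μ)
    (hc : c ∈ B) (hl : 0 ≤ l) (hq : 0 < q) (hlq : l ≤ q) (hx : 0 ≤ x)
    (hbudget : 9 / 4 * finrank ℝ E + x + 5 ≤ 23 / 20 * (l * q)) :
    μ {w | ∃ u ∈ B, q ^ 2 + dist u c ^ 2 / 2 ≤ (X u w - X c w) / 3} ≤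
      ENNReal.ofReal (Real.exp (-x)) := by
  let shell (j : ℕ) : Set E := B ∩ Metric.closedBall c (q * shellRadius j)
  let shellEvent (j : ℕ) : Set Ω := {w | ∃ u ∈ shell j,
    l ^ 2 / 2 + 9 / 4 * finrank ℝ E + (x + (j + 1) * Real.log 2) ≤
      l * (X u w - X c w) / (2 * (q * shellRadius j))}
  have radius_pos (j : ℕ) : 0 < q * shellRadius j := mul_pos hq (shellRadius_pos j)
  have measure_shellEvent_le (j : ℕ) : μ (shellEvent j) ≤
      ENNReal.ofReal (Real.exp (-(x + (j + 1) * Real.log 2))) :=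
    (h.mono inter_subset_left le_rfl).measure_exists_ge_le (radius_pos j) hl
      ⟨hc, Metric.mem_closedBall_self (radius_pos j).le⟩ inter_subset_right _
  have subset_shellEvents :
      {w | ∃ u ∈ B, q ^ 2 + dist u c ^ 2 / 2 ≤ (X u w - X c w) / 3} ⊆ ⋃ j, shellEvent j := by
    rintro w ⟨u, hu, hlarge⟩
    obtain ⟨j, hdist, hgain⟩ := exists_shell (dist u c / q)
    have hexp := shell_exponent_le (Nat.cast_nonneg _) hx hbudget j
    set gain : ℝ := max (11 / 10 : ℝ) (3 / 20 * (j + 1))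
    have gain_le : q ^ 2 * (gain * shellRadius j) ≤ (X u w - X c w) / 3 :=
      calc q ^ 2 * (gain * shellRadius j) ≤ q ^ 2 * (1 + (dist u c / q) ^ 2 / 2) := by gcongr
        _ = q ^ 2 + dist u c ^ 2 / 2 := by field_simp
        _ ≤ _ := hlarge
    have le_deviation :
        3 / 2 * (l * q) * gain ≤ l * (X u w - X c w) / (2 * (q * shellRadius j)) := by
      rw [le_div_iff₀ (mul_pos two_pos (radius_pos j))]
      linarith [mul_le_mul_of_nonneg_left gain_le hl]
    refine mem_iUnion.2 ⟨j, u, ⟨hu, Metric.mem_closedBall.2 ((div_le_iff₀' hq).1 hdist)⟩, ?_⟩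
    nlinarith
  calc _ ≤ μ (⋃ j, shellEvent j) := measure_mono subset_shellEvents
    _ ≤ ∑' j, μ (shellEvent j) := measure_iUnion_le _
    _ ≤ ∑' j : ℕ, ENNReal.ofReal (Real.exp (-x)) * ENNReal.ofReal ((1 / 2) ^ (j + 1)) := by
        refine ENNReal.tsum_le_tsum fun j => (measure_shellEvent_le j).trans_eq ?_
        rw [exp_neg_add_succ_mul_log_two, ENNReal.ofReal_mul (Real.exp_pos _).le]
    _ = _ := by rw [ENNReal.tsum_mul_left, tsum_ofReal_half_pow_succ, mul_one]

end HasLocalSubgaussianIncrements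

lemma entropyConst_nonneg (p : ℕ) : 0 ≤ entropyConst p := by
  unfold entropyConst
  positivity

lemma entropy_budget_le {p : ℕ} (hp : p ≠ 0) (hx : 0 ≤ x) :
    9 / 4 * p + x + 5 ≤ 9 / 8 * (1 + √(x + entropyConst p)) ^ 2 := by
  have hsq := Real.sq_sqrt (add_nonneg hx (entropyConst_nonneg p))
  rcases eq_or_ne p 1 with rfl | hp1
  · have hQ : entropyConst 1 = 27 / 10 := by norm_num [entropyConst]
    have hσ : 41 / 25 ≤ √(x + entropyConst 1) := by
      apply Real.le_sqrt_of_sq_le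
      rw [hQ]
      linarith
    rw [hQ] at hsq hσ ⊢
    push_cast
    nlinarith
  · have hQ : entropyConst p = 2 * p := by simp [entropyConst, hp1]
    have hp2 : (2 : ℝ) ≤ p := by exact_mod_cast (Nat.two_le_iff p).2 ⟨hp, hp1⟩
    have hσ : 2 ≤ √(x + entropyConst p) := by
      apply Real.le_sqrt_of_sq_le
      rw [hQ]
      linarith
    rw [hQ] at hsq hσ ⊢
    nlinarith

lemma zQuant_pos {g₀ Q : ℝ} : 0 < zQuant g₀ x Q := by
  unfold zQuant
  split_ifs <;> positivity

namespace HasLocalSubgaussianIncrements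

variable {g₀ : ℝ}

lemma exists_lt_zQuant_measure_exists_penalized_ge_le
    (h : HasLocalSubgaussianIncrements X B g₀ μ) (hc : c ∈ B) (hg₀ : 3 ≤ g₀) (hx : 0 ≤ x) :
    ∃ z, 0 ≤ z ∧ z < zQuant g₀ x (entropyConst (finrank ℝ E)) ∧
      μ {w | ∃ u ∈ B, z + dist u c ^ 2 / 2 ≤ (X u w - X c w) / 3} ≤
        ENNReal.ofReal (Real.exp (-x)) := by
  rcases eq_or_ne (finrank ℝ E) 0 with hdim | hdim
  · have : Subsingleton E := finrank_zero_iff.1 hdim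
    refine ⟨_, (half_pos zQuant_pos).le, half_lt_self zQuant_pos, ?_⟩
    have hz : ¬zQuant g₀ x (entropyConst (finrank ℝ E)) / 2 ≤ 0 := (half_pos zQuant_pos).not_ge
    simp [Subsingleton.elim _ c, hz]
  have hbudget := entropy_budget_le hdim hx
  set Q := entropyConst (finrank ℝ E)
  have hQ : 0 ≤ x + Q := add_nonneg hx (entropyConst_nonneg _)
  have hsq := Real.sq_sqrt hQ
  set σ := √(x + Q)
  have hσ₀ : 0 ≤ σ := Real.sqrt_nonneg _
  unfold zQuant
  split_ifs with hle
  · have hq : 0 < 99 / 100 * (1 + σ) := by positivity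
    refine ⟨(99 / 100 * (1 + σ)) ^ 2, sq_nonneg _, by nlinarith, ?_⟩
    exact (h.mono subset_rfl (by linarith)).measure_exists_penalized_ge_le hc hq.le hq le_rfl hx
      (by nlinarith)
  · have hq : g₀ ≤ 2 * g₀⁻¹ * (x + Q) + g₀ := le_add_of_nonneg_left (by positivity)
    refine ⟨(2 * g₀⁻¹ * (x + Q) + g₀) ^ 2, sq_nonneg _, by linarith, ?_⟩
    refine h.measure_exists_penalized_ge_le hc (by linarith) (by linarith) hq hx ?_
    have hlevel : g₀ * (2 * g₀⁻¹ * (x + Q) + g₀) = 2 * σ ^ 2 + g₀ ^ 2 := by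
      rw [hsq]
      field_simp
    rw [hlevel]
    nlinarith [sq_nonneg (σ - 1)]

end HasLocalSubgaussianIncrements

lemma exists_lt_of_le_inv_mul_iSup {ι : Type*} {S : Set ι} {f : ι → ℝ} {ω z Z : ℝ} (hω : 0 < ω)
    (hz : z < Z) (hle : (Z : EReal) ≤ ((ω⁻¹ : ℝ) : EReal) * ⨆ i ∈ S, (f i : EReal)) :
    ∃ i ∈ S, ω * z < f i := by
  by_contra! hcon
  have iSup_le : (⨆ i ∈ S, (f i : EReal)) ≤ ((ω * z : ℝ) : EReal) :=
    iSup₂_le fun i hi => EReal.coe_le_coe_iff.2 (hcon i hi)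
  have hZ : (Z : EReal) ≤ ((ω⁻¹ * (ω * z) : ℝ) : EReal) := by
    rw [EReal.coe_mul]
    exact hle.trans (mul_le_mul_of_nonneg_left iSup_le (EReal.coe_nonneg.2 (inv_nonneg.2 hω.le)))
  rw [inv_mul_cancel_left₀ hω.ne', EReal.coe_le_coe_iff] at hZ
  exact hZ.not_gt hz

lemma HasLocalSubgaussianIncrements.measure_zQuant_le_iSup_le {g₀ δ ω : ℝ}
    (h : HasLocalSubgaussianIncrements X B g₀ μ) (hc : c ∈ B) (hg₀ : 3 ≤ g₀) (hδ : 0 < δ)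
    (hδω : 3 * δ ≤ ω) (hx : 0 ≤ x) :
    μ {w | (zQuant g₀ x (entropyConst (finrank ℝ E)) : EReal) ≤ ((ω⁻¹ : ℝ) : EReal) *
      ⨆ u ∈ B, ((δ * (X u w - X c w) - ω / 2 * dist u c ^ 2 : ℝ) : EReal)} ≤
      ENNReal.ofReal (Real.exp (-x)) := by
  obtain ⟨z, hz₀, hz, hmeasure⟩ :=
    h.exists_lt_zQuant_measure_exists_penalized_ge_le hc hg₀ hx
  refine (measure_mono fun w hw => ?_).trans hmeasure
  have hω : 0 < ω := by linarith
  obtain ⟨u, hu, hlarge⟩ := exists_lt_of_le_inv_mul_iSup hω hz hw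
  refine ⟨u, hu, ?_⟩
  have penalty_nonneg : 0 ≤ ω * (z + dist u c ^ 2 / 2) := by positivity
  have increment_pos : 0 < X u w - X c w := by
    by_contra! hneg
    linarith [mul_nonpos_of_nonneg_of_nonpos hδ.le hneg]
  refine le_of_mul_le_mul_left ?_ hω
  nlinarith

end Peeling

section Bracketing

variable {Ω : Type*} [MeasurableSpace Ω] {μ : Measure Ω} {p : ℕ} {L : ParamSpace p → Ω → ℝ}
  {Θ S : Set (ParamSpace p)} {θs θ θ' γ : ParamSpace p} {w : Ω}
  {V : Matrix (Fin p) (Fin p) ℝ} {ν g c : ℝ}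

/-- The action of an invertible matrix `V` on `ℝ^p`. It is an isometry from `ℝ^p` normed by
`matNorm V` onto Euclidean space, which is how the chaining bound is transferred. -/
noncomputable def normalization (hV : IsUnit V) : ParamSpace p ≃L[ℝ] ParamSpace p :=
  ContinuousLinearEquiv.ofUnit (hV.map (Matrix.toEuclideanCLM (n := Fin p) (𝕜 := ℝ))).unit

lemma norm_normalization (hV : IsUnit V) (γ : ParamSpace p) :
    ‖normalization hV γ‖ = matNorm V γ := rfl

lemma dist_normalization (hV : IsUnit V) (θ θ' : ParamSpace p) :
    dist (normalization hV θ) (normalization hV θ') = matNorm V (θ - θ') := by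
  rw [dist_eq_norm, ← map_sub, norm_normalization]

lemma matNorm_pos (hV : IsUnit V) (hγ : γ ≠ 0) : 0 < matNorm V γ := by
  rw [← norm_normalization hV, norm_pos_iff]
  exact (normalization hV).map_ne_zero_iff.2 hγ

lemma hasDerivWithinAt_stochComp_segment
    (hw : DifferentiableOn ℝ (fun θ => stochComp μ L θ w) Θ)
    (hseg : ∀ t ∈ Icc (0 : ℝ) 1, θ' + t • γ ∈ Θ) {t : ℝ} (ht : t ∈ Icc (0 : ℝ) 1) :
    HasDerivWithinAt (fun s => stochComp μ L (θ' + s • γ) w)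
      (inner ℝ γ (gradStoch μ L Θ (θ' + t • γ) w)) (Icc 0 1) t := by
  have hline : HasDerivWithinAt (fun s : ℝ => θ' + s • γ) γ (Icc 0 1) t := by
    simpa using (((hasDerivAt_id t).smul_const γ).const_add θ').hasDerivWithinAt
  rw [real_inner_comm]
  exact ((hw _ (hseg t ht)).hasFDerivWithinAt.comp_hasDerivWithinAt t hline hseg).congr_deriv
    InnerProductSpace.toDual_symm_apply.symm

lemma hasDerivWithinAt_linRemainder_segment
    (hw : DifferentiableOn ℝ (fun θ => stochComp μ L θ w) Θ)
    (hseg : ∀ t ∈ Icc (0 : ℝ) 1, θ' + t • γ ∈ Θ) {t : ℝ} (ht : t ∈ Icc (0 : ℝ) 1) :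
    HasDerivWithinAt (fun s => linRemainder μ L Θ θs (θ' + s • γ) w)
      (inner ℝ γ (gradStoch μ L Θ (θ' + t • γ) w - gradStoch μ L Θ θs w)) (Icc 0 1) t := by
  have hlinear : HasDerivWithinAt
      (fun s : ℝ => inner ℝ (θ' + s • γ - θs) (gradStoch μ L Θ θs w))
      (inner ℝ γ (gradStoch μ L Θ θs w)) (Icc 0 1) t := by
    have hline : HasDerivWithinAt (fun s : ℝ => θ' + s • γ - θs) γ (Icc 0 1) t := by
      simpa using ((((hasDerivAt_id t).smul_const γ).const_add θ').sub_const θs).hasDerivWithinAt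
    simpa using hline.inner ℝ (hasDerivWithinAt_const t (Icc (0 : ℝ) 1) (gradStoch μ L Θ θs w))
  rw [inner_sub_right]
  exact ((hasDerivWithinAt_stochComp_segment hw hseg ht).sub_const _).sub hlinear

lemma aemeasurable_linRemainder (hL : ∀ θ ∈ Θ, AEMeasurable (L θ) μ)
    (hdiff : ∀ᵐ w ∂μ, DifferentiableOn ℝ (fun θ => stochComp μ L θ w) Θ)
    (hseg : segment ℝ θs θ ⊆ Θ) : AEMeasurable (fun w => linRemainder μ L Θ θs θ w) μ := by
  have hζ : ∀ θ ∈ Θ, AEMeasurable (fun w => stochComp μ L θ w) μ := fun θ hθ =>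
    (hL θ hθ).sub_const _
  have hline : ∀ t ∈ Icc (0 : ℝ) 1, θs + t • (θ - θs) ∈ Θ := fun t ht =>
    hseg (segment_eq_image' ℝ θs θ ▸ mem_image_of_mem _ ht)
  have hgrad : AEMeasurable (fun w => inner ℝ (θ - θs) (gradStoch μ L Θ θs w)) μ := by
    refine (aestronglyMeasurable_of_hasDerivWithinAt (s := Icc 0 1) (t := 0)
      (F := fun t w => stochComp μ L (θs + t • (θ - θs)) w) (by simp) ?_
      (fun t ht => (hζ _ (hline t ht)).aestronglyMeasurable) ?_).aemeasurable
    · rw [Icc_sdiff_left, closure_Ioc zero_ne_one]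
      exact left_mem_Icc.2 zero_le_one
    · filter_upwards [hdiff] with w hw
      simpa using hasDerivWithinAt_stochComp_segment hw hline (left_mem_Icc.2 zero_le_one)
  exact ((hζ _ (hseg (right_mem_segment ℝ θs θ))).sub
    (hζ _ (hseg (left_mem_segment ℝ θs θ)))).sub hgrad

/-- The moment bound of `ConditionED1` at a single radius, over an arbitrary set `S` in place of
`Θ₀(r)` and with a constant `c` in place of `ρ r`. -/
def HasGradientMomentBound (μ : Measure Ω) (L : ParamSpace p → Ω → ℝ) (Θ S : Set (ParamSpace p))
    (V : Matrix (Fin p) (Fin p) ℝ) (θs : ParamSpace p) (ν g c : ℝ) : Prop :=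
  ∀ θ ∈ S, ∀ γ : ParamSpace p, γ ≠ 0 → ∀ t : ℝ, |t| ≤ g →
    Integrable (fun w => Real.exp (t *
      (inner ℝ γ (gradStoch μ L Θ θ w - gradStoch μ L Θ θs w) / (c * matNorm V γ)))) μ ∧
    Real.log (∫ w, Real.exp (t *
      (inner ℝ γ (gradStoch μ L Θ θ w - gradStoch μ L Θ θs w) / (c * matNorm V γ))) ∂μ)
        ≤ ν ^ 2 * t ^ 2 / 2

namespace HasGradientMomentBound

lemma lintegral_exp_le [NeZero μ] (h : HasGradientMomentBound μ L Θ S V θs ν g c) (hθ : θ ∈ S)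
    (hγ : γ ≠ 0) {t : ℝ} (ht : |t| ≤ g) :
    ∫⁻ w, ENNReal.ofReal (Real.exp (t / (c * matNorm V γ) *
      inner ℝ γ (gradStoch μ L Θ θ w - gradStoch μ L Θ θs w))) ∂μ ≤
        ENNReal.ofReal (Real.exp (ν ^ 2 * t ^ 2 / 2)) := by
  obtain ⟨hint, hlog⟩ := h θ hθ γ hγ t ht
  rw [Real.log_le_iff_le_exp (integral_exp_pos hint)] at hlog
  simp_rw [div_mul_eq_mul_div, ← mul_div_assoc] at hint hlog ⊢
  rw [← ofReal_integral_eq_lintegral_ofReal hint (.of_forall fun _ => (Real.exp_pos _).le)]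
  exact ENNReal.ofReal_le_ofReal hlog

lemma lintegral_enorm_inner_le [NeZero μ] (h : HasGradientMomentBound μ L Θ S V θs ν g c)
    (hθ : θ ∈ S) (hγ : γ ≠ 0) (hg : 0 < g) (hc : 0 < c * matNorm V γ) :
    ∫⁻ w, ‖inner ℝ γ (gradStoch μ L Θ θ w - gradStoch μ L Θ θs w)‖ₑ ∂μ ≤
      ENNReal.ofReal (g / (c * matNorm V γ))⁻¹ *
        (ENNReal.ofReal (Real.exp (ν ^ 2 * g ^ 2 / 2)) +
          ENNReal.ofReal (Real.exp (ν ^ 2 * g ^ 2 / 2))) := by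
  have hmeas := aemeasurable_of_integrable_exp_mul (neg_lt_self hg).ne
    (h θ hθ γ hγ (-g) (by rw [abs_neg, abs_of_pos hg])).1 (h θ hθ γ hγ g (abs_of_pos hg).le).1
  refine lintegral_enorm_le_of_lintegral_exp_le (div_pos hg hc)
    (by simpa only [div_mul_cancel₀ _ hc.ne'] using hmeas.mul_const (c * matNorm V γ))
    (h.lintegral_exp_le hθ hγ (abs_of_pos hg).le) ?_
  simpa only [neg_sq, neg_div] using
    h.lintegral_exp_le hθ hγ (t := -g) (by rw [abs_neg, abs_of_pos hg])

lemma lintegral_exp_linRemainder_sub_le [IsProbabilityMeasure μ]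
    (h : HasGradientMomentBound μ L Θ S V θs ν g c) (hV : IsUnit V) (hSΘ : S ⊆ Θ)
    (hS : Convex ℝ S) (hθs : θs ∈ S) (hL : ∀ θ ∈ Θ, AEMeasurable (L θ) μ)
    (hdiff : ∀ᵐ w ∂μ, DifferentiableOn ℝ (fun θ => stochComp μ L θ w) Θ) (hν : 0 < ν)
    (hg : 0 < g) (hc : 0 < c) (hθ : θ ∈ S) (hθ' : θ' ∈ S) {κ : ℝ} (hκ : 0 ≤ κ)
    (hκg : κ * matNorm V (θ - θ') ≤ g * ν) :
    ∫⁻ w, ENNReal.ofReal (Real.exp (κ / (ν * c) *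
      (linRemainder μ L Θ θs θ w - linRemainder μ L Θ θs θ' w))) ∂μ ≤
        ENNReal.ofReal (Real.exp ((κ * matNorm V (θ - θ')) ^ 2 / 2)) := by
  rcases eq_or_ne (θ - θ') 0 with hγ | hγ
  · simp [sub_eq_zero.1 hγ, matNorm]
  have hd := matNorm_pos hV hγ
  have hmem : ∀ t ∈ Icc (0 : ℝ) 1, θ' + t • (θ - θ') ∈ S := fun t ht =>
    hS.add_smul_sub_mem hθ' hθ ht
  have hexp : ∀ t ∈ Icc (0 : ℝ) 1, ∫⁻ w, ENNReal.ofReal (Real.exp (κ / (ν * c) * inner ℝ (θ - θ')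
      (gradStoch μ L Θ (θ' + t • (θ - θ')) w - gradStoch μ L Θ θs w))) ∂μ ≤
        ENNReal.ofReal (Real.exp ((κ * matNorm V (θ - θ')) ^ 2 / 2)) := by
    intro t ht
    have hle : |κ * matNorm V (θ - θ') / ν| ≤ g := by
      rwa [abs_of_nonneg (by positivity), div_le_iff₀ hν]
    convert h.lintegral_exp_le (hmem t ht) hγ hle using 6
    · field_simp
    · field_simp
  have hincrement := lintegral_convex_increment_le
    (F := fun t => linRemainder μ L Θ θs (θ' + t • (θ - θ')))
    (φ := fun y => Real.exp (κ / (ν * c) * y))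
    (fun t ht => (aemeasurable_linRemainder hL hdiff
      ((hS.segment_subset hθs (hmem t ht)).trans hSΘ)).aestronglyMeasurable)
    (by
      filter_upwards [hdiff] with w hw t ht
      exact hasDerivWithinAt_linRemainder_segment hw (fun s hs => hSΘ (hmem s hs)) ht)
    (by finiteness) (fun t ht => h.lintegral_enorm_inner_le (hmem t ht) hγ hg (mul_pos hc hd))
    (convexOn_exp.comp_linearMap (LinearMap.mul ℝ ℝ (κ / (ν * c)))) (by fun_prop)
    (fun _ => (Real.exp_pos _).le) hexp
  simpa using hincrement

lemma hasLocalSubgaussianIncrements [IsProbabilityMeasure μ]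
    (h : HasGradientMomentBound μ L Θ S V θs ν g c) (hV : IsUnit V) (hSΘ : S ⊆ Θ)
    (hS : Convex ℝ S) (hθs : θs ∈ S) (hL : ∀ θ ∈ Θ, AEMeasurable (L θ) μ)
    (hdiff : ∀ᵐ w ∂μ, DifferentiableOn ℝ (fun θ => stochComp μ L θ w) Θ) (hν : 0 < ν)
    (hg : 0 < g) (hc : 0 < c) :
    HasLocalSubgaussianIncrements
      (fun u w => (ν * c)⁻¹ * linRemainder μ L Θ θs ((normalization hV).symm u) w)
      (normalization hV '' S) (g * ν) μ where
  aemeasurable := by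
    rintro _ ⟨θ, hθ, rfl⟩
    simpa only [ContinuousLinearEquiv.symm_apply_apply] using
      (aemeasurable_linRemainder hL hdiff ((hS.segment_subset hθs hθ).trans hSΘ)).const_mul _
  ae_continuousOn := by
    filter_upwards [hdiff] with w hw
    have hmaps : MapsTo (normalization hV).symm (normalization hV '' S) Θ := by
      rintro _ ⟨θ, hθ, rfl⟩
      simpa using hSΘ hθ
    have hζ := hw.continuousOn.comp (normalization hV).symm.continuous.continuousOn hmaps
    unfold linRemainder
    fun_prop
  lintegral_exp_sub_le := by
    rintro _ ⟨θ, hθ, rfl⟩ _ ⟨θ', hθ', rfl⟩ κ hκ hκg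
    rw [dist_normalization] at hκg ⊢
    simpa only [ContinuousLinearEquiv.symm_apply_apply, ← mul_sub, ← mul_assoc,
      div_eq_mul_inv] using
      h.lintegral_exp_linRemainder_sub_le hV hSΘ hS hθs hL hdiff hν hg hc hθ hθ' hκ hκg

end HasGradientMomentBound

theorem mainTheorem2_general [IsProbabilityMeasure μ] (hθs : θs ∈ S) (hSΘ : S ⊆ Θ)
    (hS : Convex ℝ S) (hL : ∀ θ ∈ Θ, Integrable (L θ) μ)
    (hdiff : ∀ᵐ w ∂μ, DifferentiableOn ℝ (fun θ => stochComp μ L θ w) Θ) (hV : IsUnit V)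
    (hν : 0 < ν) (hg : 3 ≤ g * ν) (hc : 0 < c) (h : HasGradientMomentBound μ L Θ S V θs ν g c)
    {ω : ℝ} (hω : 3 * ν * c ≤ ω) {x : ℝ} (hx : 0 ≤ x) :
    μ {w | (zQuant (g * ν) x (entropyConst p) : EReal) ≤ ((ω⁻¹ : ℝ) : EReal) * ⨆ θ ∈ S,
      ((linRemainder μ L Θ θs θ w - ω / 2 * matNorm V (θ - θs) ^ 2 : ℝ) : EReal)} ≤
        ENNReal.ofReal (Real.exp (-x)) ∧
    μ {w | (zQuant (g * ν) x (entropyConst p) : EReal) ≤ ((ω⁻¹ : ℝ) : EReal) * ⨆ θ ∈ S,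
      ((-linRemainder μ L Θ θs θ w - ω / 2 * matNorm V (θ - θs) ^ 2 : ℝ) : EReal)} ≤
        ENNReal.ofReal (Real.exp (-x)) := by
  have hνc : 0 < ν * c := mul_pos hν hc
  have hsub := h.hasLocalSubgaussianIncrements hV hSΘ hS hθs (fun θ hθ => (hL θ hθ).aemeasurable)
    hdiff hν (pos_of_mul_pos_left (by linarith) hν.le) hc
  have hνω : 3 * (ν * c) ≤ ω := by rwa [← mul_assoc]
  have hbase : ∀ w, linRemainder μ L Θ θs θs w = 0 := fun w => by simp [linRemainder]
  have hcenter := mem_image_of_mem (normalization hV) hθs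
  have hupper := hsub.measure_zQuant_le_iSup_le hcenter hg hνc hνω hx
  have hlower := hsub.neg.measure_zQuant_le_iSup_le hcenter hg hνc hνω hx
  simp only [iSup_image, ContinuousLinearEquiv.symm_apply_apply, dist_normalization, hbase,
    finrank_euclideanSpace_fin, mul_zero, neg_zero, sub_zero, mul_neg,
    mul_inv_cancel_left₀ hνc.ne'] at hupper hlower
  exact ⟨hupper, hlower⟩

end Bracketing

end

theorem mainTheorem2 {Ω : Type*} [MeasurableSpace Ω] (μ : Measure Ω) [IsProbabilityMeasure μ]
    {p : ℕ} (Θ : Set (ParamSpace p)) (L : ParamSpace p → Ω → ℝ) (θs : ParamSpace p)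
    (hθs : θs ∈ Θ)
    (hL : ∀ θ ∈ Θ, Integrable (L θ) μ)
    (hdiff : ∀ᵐ w ∂μ, DifferentiableOn ℝ (fun θ => stochComp μ L θ w) Θ)
    (V : Matrix (Fin p) (Fin p) ℝ) (hV : V.PosDef)
    (ν g r₀ : ℝ) (ρ : ℝ → ℝ) (hν : 1 ≤ ν) (hg : 3 ≤ g * ν)
    (hED1 : ConditionED1 μ L Θ V θs ν g r₀ ρ)
    (r : ℝ) (hr : 0 < r) (hrr₀ : r ≤ r₀)
    (hconv : Convex ℝ (localSet Θ V θs r))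
    (ω : ℝ) (hω : 3 * ν * ρ r ≤ ω)
    (x : ℝ) (hx : 0 ≤ x) :
    μ {w | ((zQuant (g * ν) x (entropyConst p) : ℝ) : EReal)
        ≤ ((ω⁻¹ : ℝ) : EReal) * upperError μ L Θ V θs ω r w} ≤ ENNReal.ofReal (Real.exp (-x)) ∧
    μ {w | ((zQuant (g * ν) x (entropyConst p) : ℝ) : EReal)
        ≤ ((ω⁻¹ : ℝ) : EReal) * lowerError μ L Θ V θs ω r w} ≤ ENNReal.ofReal (Real.exp (-x)) := by
  exact mainTheorem2_general (S := localSet Θ V θs r) ⟨hθs, by simpa [matNorm] using hr.le⟩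
    (fun _ h => h.1) hconv hL hdiff hV.isUnit
    (zero_lt_one.trans_le hν) hg (hED1 r hr hrr₀).1 (hED1 r hr hrr₀).2.2 hω hx
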